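/- **Setting.** Consider an identical-interest game with players $1,\dots,n$ who each have two actions, i.e. all players share one utility function $u$, extended multilinearly to mixed profiles. A family of such games is *concise* if $u$ is computed on mixed profiles by a multilinear arithmetic circuit (gates: inputs $x_i(a)$, rational constants, $+$, $\times$; the two inputs of each $\times$-gate induce disjoint sub-circuits that involve disjoint sets of players) whose size in bits is polynomial in $n$. For $\epsilon>0$ and an action profile $a$, let $a^{(\epsilon)}$ be the mixed profile in which each player $i$ plays $a_i$ with probability $1-\epsilon$ and the other action with probability $\epsilon$. Switching from $a_i$ to $b$ is a *better response* if $u(b,a_{-i})>u(a)$, and an *$\epsilon$-symbolic better response* if $u\big((b,a_{-i})^{(\epsilon)}\big)>u\big(a^{(\epsilon)}\big)$ for all sufficiently small $\epsilon>0$. (With two actions, better and best responses coincide.) In *round-robin* dynamics the players take turns in a fixed cyclic order; a player who has an improving switch at its turn makes it, which is called an improvement step, and otherwise nothing changes. A *pure perfect equilibrium* is an action profile that is a limit, as $\epsilon\to0^+$ along some sequence, of fully mixed profiles in which all actions have probability at least $\epsilon$ and every action that is not a best response has probability at most $\epsilon$. **Theorem.** There are a constant $c>0$ and, for arbitrarily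 large $n$, concise identical-interest games with $n$ players and two actions per player such that: 1. From every starting action profile, round-robin $\epsilon$-symbolic better-response dynamics with player order $1,2,\dots,n$ reach a pure perfect equilibrium, and stay there, within $n$ turns, hence after at most $n$ improvement steps; with any other cyclic order of the players they do so within $2n$ turns. 2. There is a starting action profile from which every sequence of better-response improvement steps that reaches a pure Nash equilibrium, no matter which players move in which order, has at least $2^{cn}$ steps. -/

import Mathlib

open Filter Topology

/-! ### Normal-form games -/

/-- A normal-form game with players `Fin n`, in which player `i` has the action set `A i`. -/
structure NormalFormGame {n : ℕ} (A : Fin n → Type) where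
  /-- `utility i a` is the payoff of player `i` at the action profile `a`. -/
  utility : Fin n → (∀ j, A j) → ℝ

namespace NormalFormGame

variable {n : ℕ} {A : Fin n → Type} [∀ i, Fintype (A i)] [∀ i, DecidableEq (A i)]

/-- All players have the same utility function. -/
def IsIdenticalInterest (G : NormalFormGame A) : Prop :=
  ∀ i j a, G.utility i a = G.utility j a

/-- `x` is a profile of mixed strategies: every `x i` is a probability distribution on `A i`. -/
def IsMixedProfile (x : ∀ i, A i → ℝ) : Prop :=
  ∀ i, (∀ b, 0 ≤ x i b) ∧ ∑ b, x i b = 1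

/-- The pure strategy that plays `b` with probability one. -/
def pureStrategy {i : Fin n} (b : A i) : A i → ℝ :=
  fun b' => if b' = b then 1 else 0

/-- The utility of player `i` at a mixed profile, extended multilinearly from action profiles. -/
noncomputable def expectedUtility (G : NormalFormGame A) (i : Fin n) (x : ∀ j, A j → ℝ) : ℝ :=
  ∑ a : (∀ j, A j), G.utility i a * ∏ j, x j (a j)

/-! ### Pure Nash and pure perfect equilibria -/

/-- No player gains by a unilateral deviation from the action profile `a`. -/
def IsPureNash (G : NormalFormGame A) (a : ∀ j, A j) : Prop :=
  ∀ i (b : A i), G.utility i (Function.update a i b) ≤ G.utility i a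

/-- Membership in the strategy set of the `ε`-perturbed game: every player plays a probability
distribution in which every action has probability at least `ε`. -/
def IsPerturbedProfile (ε : ℝ) (x : ∀ i, A i → ℝ) : Prop :=
  IsMixedProfile x ∧ ∀ i b, ε ≤ x i b

/-- `x` is an `ε`-perfect equilibrium: it is a fully mixed profile, and an action that is not a
best response against `x` is played with probability at most `ε`. -/
def IsEpsPerfect (G : NormalFormGame A) (ε : ℝ) (x : ∀ i, A i → ℝ) : Prop :=
  IsMixedProfile x ∧ (∀ i b, 0 < x i b) ∧
    ∀ i (b b' : A i),
      G.expectedUtility i (Function.update x i (pureStrategy b)) <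
        G.expectedUtility i (Function.update x i (pureStrategy b')) → x i b ≤ ε

/-- `x` is a (trembling-hand) perfect equilibrium: it is the limit of `ε`-perfect equilibria of
the `ε`-perturbed games along a sequence of positive `ε` that tends to `0`. -/
def IsPerfect (G : NormalFormGame A) (x : ∀ i, A i → ℝ) : Prop :=
  ∃ (ε : ℕ → ℝ) (y : ℕ → ∀ i, A i → ℝ),
    (∀ k, 0 < ε k) ∧ Tendsto ε atTop (𝓝 0) ∧
    (∀ k, IsPerturbedProfile (ε k) (y k) ∧ G.IsEpsPerfect (ε k) (y k)) ∧
    Tendsto y atTop (𝓝 x)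

/-- The action profile `a`, viewed as a mixed profile, is a perfect equilibrium. -/
def IsPurePerfect (G : NormalFormGame A) (a : ∀ j, A j) : Prop :=
  G.IsPerfect (fun i => pureStrategy (a i))

/-! ### Better responses, ordinary and symbolic -/

/-- Switching to `b` strictly improves the utility of player `i` at the action profile `a`. (If
player `i` has two actions, such a `b` is the best response of `i`.) -/
def IsBetterResponse (G : NormalFormGame A) (i : Fin n) (a : ∀ j, A j) (b : A i) : Prop :=
  G.utility i a < G.utility i (Function.update a i b)

/-- The `ε`-pure profile of the perturbed game at `a`: player `i` plays every action other than
`a i` with probability `ε`, and `a i` with the remaining probability. -/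
def epsPure (ε : ℝ) (a : ∀ j, A j) : ∀ i, A i → ℝ :=
  fun i b => if b = a i then 1 - ((Fintype.card (A i) : ℝ) - 1) * ε else ε

/-- Switching to `b` is an `ε`-symbolic better response of player `i` at `a`: for all sufficiently
small `ε > 0`, it strictly improves the utility of `i` at the `ε`-pure profile of `a`. -/
def IsSymbolicBetterResponse (G : NormalFormGame A) (i : Fin n) (a : ∀ j, A j) (b : A i) : Prop :=
  ∃ ε₀ : ℝ, 0 < ε₀ ∧ ∀ ε : ℝ, 0 < ε → ε < ε₀ →
    G.expectedUtility i (epsPure ε a) <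
      G.expectedUtility i (epsPure ε (Function.update a i b))

/-! ### Dynamics -/

/-- One turn of player `i`, from the profile `a` to the profile `a'`: if player `i` has an
improving action, then `i` switches to one of them, and otherwise nothing changes. -/
def IsTurn (better : ∀ i, (∀ j, A j) → A i → Prop) (i : Fin n) (a a' : ∀ j, A j) : Prop :=
  (∃ b, better i a b ∧ a' = Function.update a i b) ∨ ((¬ ∃ b, better i a b) ∧ a' = a)

/-- `s 0, s 1, s 2, …` is a run of the round-robin dynamics in which the players take their turns
in the cyclic order `π 0, π 1, …, π (n - 1), π 0, π 1, …`. -/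
def IsRoundRobinRun (better : ∀ i, (∀ j, A j) → A i → Prop) (π : Equiv.Perm (Fin n))
    (s : ℕ → ∀ j, A j) : Prop :=
  ∀ (t : ℕ) (i : Fin n), (i : ℕ) = t % n → IsTurn better (π i) (s t) (s (t + 1))

/-- `s 0, s 1, …, s L` is a path of `L` improvement steps: in each of them some player, chosen
arbitrarily, switches to an improving action. -/
def IsImprovementPath (better : ∀ i, (∀ j, A j) → A i → Prop) (L : ℕ)
    (s : ℕ → ∀ j, A j) : Prop :=
  ∀ t < L, ∃ i b, better i (s t) b ∧ s (t + 1) = Function.update (s t) i b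

end NormalFormGame

/-! ### Multilinear arithmetic circuits -/

/-- A gate at position `k` of an arithmetic circuit whose inputs are the probabilities `x i a`
with which player `i` plays action `a`. Its wires come from earlier positions. -/
inductive ArithGate {n : ℕ} (A : Fin n → Type) (k : ℕ) : Type
  | input (i : Fin n) (a : A i) : ArithGate A k
  | const (q : ℚ) : ArithGate A k
  | add (l r : Fin k) : ArithGate A k
  | mul (l r : Fin k) : ArithGate A k

/-- An arithmetic circuit: a directed acyclic graph of gates, in topological order. -/
structure ArithCircuit {n : ℕ} (A : Fin n → Type) where
  /-- the number of gates -/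
  size : ℕ
  /-- the gate at each position -/
  gate : (k : Fin size) → ArithGate A k
  /-- the output gate -/
  out : Fin size

namespace ArithCircuit

variable {n : ℕ} {A : Fin n → Type}

/-- The value that the gate `k` computes on the input `x`. -/
noncomputable def value (C : ArithCircuit A) (x : ∀ i, A i → ℝ) (k : Fin C.size) : ℝ :=
  match C.gate k with
  | .input i a => x i a
  | .const q => (q : ℝ)
  | .add l r => value C x ⟨l, l.isLt.trans k.isLt⟩ + value C x ⟨r, r.isLt.trans k.isLt⟩
  | .mul l r => value C x ⟨l, l.isLt.trans k.isLt⟩ * value C x ⟨r, r.isLt.trans k.isLt⟩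
termination_by k.val

/-- The output of the circuit on the input `x`. -/
noncomputable def eval (C : ArithCircuit A) (x : ∀ i, A i → ℝ) : ℝ :=
  C.value x C.out

/-- The gates of the sub-circuit induced by the gate `k`. -/
def subGates (C : ArithCircuit A) (k : Fin C.size) : Finset (Fin C.size) :=
  match C.gate k with
  | .input _ _ => {k}
  | .const _ => {k}
  | .add l r =>
      {k} ∪ (subGates C ⟨l, l.isLt.trans k.isLt⟩ ∪ subGates C ⟨r, r.isLt.trans k.isLt⟩)
  | .mul l r =>
      {k} ∪ (subGates C ⟨l, l.isLt.trans k.isLt⟩ ∪ subGates C ⟨r, r.isLt.trans k.isLt⟩)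
termination_by k.val

/-- The players on whose strategies the sub-circuit induced by the gate `k` takes inputs. -/
def players (C : ArithCircuit A) (k : Fin C.size) : Set (Fin n) :=
  {i | ∃ g ∈ C.subGates k, ∃ a, C.gate g = .input i a}

/-- The circuit is multilinear: the two inputs of any multiplication gate induce disjoint
sub-circuits, which involve disjoint sets of players. -/
def IsMultilinear (C : ArithCircuit A) : Prop :=
  ∀ (k : Fin C.size) (l r : Fin k), C.gate k = .mul l r →
    Disjoint (C.subGates ⟨l, l.isLt.trans k.isLt⟩) (C.subGates ⟨r, r.isLt.trans k.isLt⟩) ∧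
    Disjoint (C.players ⟨l, l.isLt.trans k.isLt⟩) (C.players ⟨r, r.isLt.trans k.isLt⟩)

/-- The number of bits that describe a gate, up to a constant factor: indices are written in
binary, and rational constants as reduced fractions in binary. -/
def gateBits [∀ i, Fintype (A i)] {k : ℕ} : ArithGate A k → ℕ
  | .input i _ => 1 + Nat.size i + Nat.size (Fintype.card (A i))
  | .const q => 2 + Nat.size q.num.natAbs + Nat.size q.den
  | .add l r => 1 + Nat.size l + Nat.size r
  | .mul l r => 1 + Nat.size l + Nat.size r

/-- The representation size of the circuit, up to a constant factor. -/
def bitSize [∀ i, Fintype (A i)] (C : ArithCircuit A) : ℕ :=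
  Nat.size C.out + ∑ k, gateBits (C.gate k)

/-- The circuit computes the utility of every player (hence the potential) in the
identical-interest game `G`, at all mixed profiles. -/
def Computes [∀ i, Fintype (A i)] (C : ArithCircuit A) (G : NormalFormGame A) : Prop :=
  ∀ i x, NormalFormGame.IsMixedProfile x → C.eval x = G.expectedUtility i x

end ArithCircuit

/-! Players 0 and 1 are switches. The other `2 * j` players form pairs, and their actions are a
vertex of a cube that carries an induced path with `2 ^ (j + 1) - 1` vertices. The utility is the
position on the path (zero off it) plus `2 ^ (j + 2)` times the indicator that both switches play
`true` times the number of paired players at `true`.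

Start with everyone at `false`. While both switches are off, flipping only one of them leaves their
product zero, so it is not a strict improvement. Hence only paired players move, and as the path is
induced, an improving move leads exactly to the next vertex (`rank_of_isBetterResponse`). With the
switches off, no vertex of the path but the last can be a Nash equilibrium (`rank_of_isPureNash`),
so the whole exponentially long path is walked.

Trembles break the tie. At a fully mixed profile the other switch and the reward both have positive
weight, so `true` is strictly better for each switch. Once both are on, the reward for `true`
outweighs any change of position (`eval_potential_lt`). So everyone settles at `true`, and this
profile is perfect.

For conciseness, the path is built by recursion: two fresh coordinates let it run through the
shorter path forwards and then backwards. Its position is a multilinear formula of cubic size, whose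
tree becomes a circuit in postorder. Identities and bounds need checking at pure profiles only,
because everything is affine in each player's strategy (`eq_zero_of_affine`,
`IsMultilinear.eval_mem_Icc`). -/

/-! ### Multilinear arithmetic formulas -/

/-- An arithmetic formula: an arithmetic circuit whose underlying graph is a tree. -/
inductive ArithFormula {n : ℕ} (A : Fin n → Type) : Type
  | input (i : Fin n) (a : A i) : ArithFormula A
  | const (q : ℚ) : ArithFormula A
  | add (φ ψ : ArithFormula A) : ArithFormula A
  | mul (φ ψ : ArithFormula A) : ArithFormula A

namespace ArithFormula

variable {n : ℕ} {A : Fin n → Type}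

/-- The value of a formula on the input `x`. -/
noncomputable def eval (x : ∀ i, A i → ℝ) : ArithFormula A → ℝ
  | input i a => x i a
  | const q => (q : ℝ)
  | add φ ψ => φ.eval x + ψ.eval x
  | mul φ ψ => φ.eval x * ψ.eval x

/-- The players on whose strategies a formula takes inputs. -/
def players : ArithFormula A → Set (Fin n)
  | input i _ => {i}
  | const _ => ∅
  | add φ ψ => φ.players ∪ ψ.players
  | mul φ ψ => φ.players ∪ ψ.players

/-- The factors of every product involve disjoint sets of players. -/
def IsMultilinear : ArithFormula A → Prop
  | input _ _ => True
  | const _ => True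
  | add φ ψ => φ.IsMultilinear ∧ ψ.IsMultilinear
  | mul φ ψ => φ.IsMultilinear ∧ ψ.IsMultilinear ∧ Disjoint φ.players ψ.players

/-- The number of nodes. -/
def size : ArithFormula A → ℕ
  | input _ _ => 1
  | const _ => 1
  | add φ ψ => φ.size + ψ.size + 1
  | mul φ ψ => φ.size + ψ.size + 1

/-- The largest number of bits of a constant. -/
def constBits : ArithFormula A → ℕ
  | input _ _ => 0
  | const q => Nat.size q.num.natAbs + Nat.size q.den
  | add φ ψ => max φ.constBits ψ.constBits
  | mul φ ψ => max φ.constBits ψ.constBits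

theorem size_pos (φ : ArithFormula A) : 0 < φ.size := by
  cases φ <;> simp [size]

theorem eval_congr {φ : ArithFormula A} {x y : ∀ i, A i → ℝ} (h : ∀ i ∈ φ.players, x i = y i) :
    φ.eval x = φ.eval y := by
  induction φ with
  | input i a => simp [eval, h i (by simp [players])]
  | const q => rfl
  | add φ ψ hφ hψ =>
    rw [eval, eval, hφ fun i hi => h i (Or.inl hi), hψ fun i hi => h i (Or.inr hi)]
  | mul φ ψ hφ hψ =>
    rw [eval, eval, hφ fun i hi => h i (Or.inl hi), hψ fun i hi => h i (Or.inr hi)]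

theorem eval_update_of_notMem {φ : ArithFormula A} {i : Fin n} (hi : i ∉ φ.players)
    (x : ∀ i, A i → ℝ) (p : A i → ℝ) : φ.eval (Function.update x i p) = φ.eval x :=
  eval_congr fun _ hj => Function.update_of_ne (ne_of_mem_of_not_mem hj hi) _ _

/-! ### Formulas laid out as circuits -/

/-- The gate at position `k` of a circuit whose positions from `p` on hold the nodes of the
formula in postorder. -/
def layout : ArithFormula A → (p k : ℕ) → ArithGate A k
  | input i a, _, _ => .input i a
  | const q, _, _ => .const q
  | add φ ψ, p, k =>
    if k < p + φ.size then φ.layout p k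
    else if h : k < p + φ.size + ψ.size then ψ.layout (p + φ.size) k
    else .add ⟨p + φ.size - 1, by have := φ.size_pos; have := ψ.size_pos; omega⟩
      ⟨p + φ.size + ψ.size - 1, by have := φ.size_pos; have := ψ.size_pos; omega⟩
  | mul φ ψ, p, k =>
    if k < p + φ.size then φ.layout p k
    else if h : k < p + φ.size + ψ.size then ψ.layout (p + φ.size) k
    else .mul ⟨p + φ.size - 1, by have := φ.size_pos; have := ψ.size_pos; omega⟩
      ⟨p + φ.size + ψ.size - 1, by have := φ.size_pos; have := ψ.size_pos; omega⟩

/-- The positions from `p` on of the circuit hold the nodes of the formula in postorder. -/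
def IsPlacedAt (φ : ArithFormula A) (C : ArithCircuit A) (p : ℕ) : Prop :=
  p + φ.size ≤ C.size ∧
    ∀ k : Fin C.size, p ≤ k → (k : ℕ) < p + φ.size → C.gate k = φ.layout p k

namespace IsPlacedAt

variable {φ ψ : ArithFormula A} {C : ArithCircuit A} {p : ℕ}

theorem left_of_add (h : (add φ ψ).IsPlacedAt C p) : φ.IsPlacedAt C p := by
  obtain ⟨h1, h2⟩ := h
  rw [size] at h1 h2
  refine ⟨by omega, fun k hk hk' => ?_⟩
  rw [h2 k hk (by omega), layout, if_pos hk']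

theorem right_of_add (h : (add φ ψ).IsPlacedAt C p) : ψ.IsPlacedAt C (p + φ.size) := by
  obtain ⟨h1, h2⟩ := h
  rw [size] at h1 h2
  refine ⟨by omega, fun k hk hk' => ?_⟩
  rw [h2 k (by omega) (by omega), layout, if_neg (by omega), dif_pos hk']

theorem left_of_mul (h : (mul φ ψ).IsPlacedAt C p) : φ.IsPlacedAt C p := by
  obtain ⟨h1, h2⟩ := h
  rw [size] at h1 h2
  refine ⟨by omega, fun k hk hk' => ?_⟩
  rw [h2 k hk (by omega), layout, if_pos hk']

theorem right_of_mul (h : (mul φ ψ).IsPlacedAt C p) : ψ.IsPlacedAt C (p + φ.size) := by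
  obtain ⟨h1, h2⟩ := h
  rw [size] at h1 h2
  refine ⟨by omega, fun k hk hk' => ?_⟩
  rw [h2 k (by omega) (by omega), layout, if_neg (by omega), dif_pos hk']

theorem gate_of_add (h : (add φ ψ).IsPlacedAt C p) {k : Fin C.size}
    (hk : (k : ℕ) + 1 = p + (add φ ψ).size) :
    ∃ l r : Fin k, C.gate k = .add l r ∧ (l : ℕ) + 1 = p + φ.size ∧
      (r : ℕ) + 1 = p + φ.size + ψ.size := by
  have hφ := φ.size_pos
  have hψ := ψ.size_pos
  obtain ⟨h1, h2⟩ := h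
  rw [size] at hk h1 h2
  refine ⟨⟨p + φ.size - 1, by omega⟩, ⟨p + φ.size + ψ.size - 1, by omega⟩, ?_,
    Nat.sub_add_cancel (by omega), Nat.sub_add_cancel (by omega)⟩
  rw [h2 k (by omega) (by omega), layout, if_neg (by omega), dif_neg (by omega)]

theorem gate_of_mul (h : (mul φ ψ).IsPlacedAt C p) {k : Fin C.size}
    (hk : (k : ℕ) + 1 = p + (mul φ ψ).size) :
    ∃ l r : Fin k, C.gate k = .mul l r ∧ (l : ℕ) + 1 = p + φ.size ∧
      (r : ℕ) + 1 = p + φ.size + ψ.size := by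
  have hφ := φ.size_pos
  have hψ := ψ.size_pos
  obtain ⟨h1, h2⟩ := h
  rw [size] at hk h1 h2
  refine ⟨⟨p + φ.size - 1, by omega⟩, ⟨p + φ.size + ψ.size - 1, by omega⟩, ?_,
    Nat.sub_add_cancel (by omega), Nat.sub_add_cancel (by omega)⟩
  rw [h2 k (by omega) (by omega), layout, if_neg (by omega), dif_neg (by omega)]

/-- The root of a formula that is placed in a circuit computes the value of the formula. -/
theorem value_eq (x : ∀ i, A i → ℝ) (h : φ.IsPlacedAt C p) {k : Fin C.size}
    (hk : (k : ℕ) + 1 = p + φ.size) : C.value x k = φ.eval x := by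
  induction φ generalizing p k with
  | input i a =>
    rw [size] at hk
    rw [ArithCircuit.value, h.2 k (by omega) (by rw [size]; omega)]; rfl
  | const q =>
    rw [size] at hk
    rw [ArithCircuit.value, h.2 k (by omega) (by rw [size]; omega)]; rfl
  | add φ ψ hφ hψ =>
    obtain ⟨l, r, hg, hl, hr⟩ := h.gate_of_add hk
    rw [ArithCircuit.value, hg, eval]
    exact congrArg₂ _ (hφ h.left_of_add hl) (hψ h.right_of_add hr)
  | mul φ ψ hφ hψ =>
    obtain ⟨l, r, hg, hl, hr⟩ := h.gate_of_mul hk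
    rw [ArithCircuit.value, hg, eval]
    exact congrArg₂ _ (hφ h.left_of_mul hl) (hψ h.right_of_mul hr)

/-- The root of a formula that is placed in a circuit induces the sub-circuit of its nodes. -/
theorem mem_subGates (h : φ.IsPlacedAt C p) {k : Fin C.size}
    (hk : (k : ℕ) + 1 = p + φ.size) {g : Fin C.size} (hg : g ∈ C.subGates k) :
    p ≤ g ∧ (g : ℕ) < p + φ.size ∧ ∀ i a, C.gate g = .input i a → i ∈ φ.players := by
  induction φ generalizing p k with
  | input i a =>
    have hk' := hk
    rw [size] at hk
    have hgate := h.2 k (by omega) (by rw [size]; omega)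
    rw [ArithCircuit.subGates, hgate] at hg
    obtain rfl : g = k := by simpa [layout] using hg
    refine ⟨by omega, by omega, fun j b hj => ?_⟩
    rw [hgate, layout] at hj
    cases hj
    simp [players]
  | const q =>
    have hk' := hk
    rw [size] at hk
    have hgate := h.2 k (by omega) (by rw [size]; omega)
    rw [ArithCircuit.subGates, hgate] at hg
    obtain rfl : g = k := by simpa [layout] using hg
    refine ⟨by omega, by omega, fun j b hj => ?_⟩
    rw [hgate, layout] at hj
    cases hj
  | add φ ψ hφ hψ =>
    obtain ⟨l, r, hgate, hl, hr⟩ := h.gate_of_add hk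
    rw [size] at hk ⊢
    rw [ArithCircuit.subGates, hgate] at hg
    simp only [Finset.mem_union, Finset.mem_singleton] at hg
    rcases hg with rfl | hg | hg
    · refine ⟨by omega, by omega, fun j b hj => ?_⟩
      rw [hgate] at hj
      cases hj
    · obtain ⟨h1, h2, h3⟩ := hφ h.left_of_add hl hg
      exact ⟨h1, by omega, fun j b hj => Or.inl (h3 j b hj)⟩
    · obtain ⟨h1, h2, h3⟩ := hψ h.right_of_add hr hg
      exact ⟨by omega, by omega, fun j b hj => Or.inr (h3 j b hj)⟩
  | mul φ ψ hφ hψ =>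
    obtain ⟨l, r, hgate, hl, hr⟩ := h.gate_of_mul hk
    rw [size] at hk ⊢
    rw [ArithCircuit.subGates, hgate] at hg
    simp only [Finset.mem_union, Finset.mem_singleton] at hg
    rcases hg with rfl | hg | hg
    · refine ⟨by omega, by omega, fun j b hj => ?_⟩
      rw [hgate] at hj
      cases hj
    · obtain ⟨h1, h2, h3⟩ := hφ h.left_of_mul hl hg
      exact ⟨h1, by omega, fun j b hj => Or.inl (h3 j b hj)⟩
    · obtain ⟨h1, h2, h3⟩ := hψ h.right_of_mul hr hg
      exact ⟨by omega, by omega, fun j b hj => Or.inr (h3 j b hj)⟩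

/-- In postorder the two factors of a product occupy disjoint intervals of positions, so their
sub-circuits share no gate. Disjointness of the players is inherited from the formula. -/
theorem disjoint_of_gate_eq_mul (hm : φ.IsMultilinear) (h : φ.IsPlacedAt C p) {k : Fin C.size}
    (hpk : p ≤ k) (hk : (k : ℕ) < p + φ.size) {l r : Fin k} (hg : C.gate k = .mul l r) :
    Disjoint (C.subGates ⟨l, l.isLt.trans k.isLt⟩) (C.subGates ⟨r, r.isLt.trans k.isLt⟩) ∧
    Disjoint (C.players ⟨l, l.isLt.trans k.isLt⟩) (C.players ⟨r, r.isLt.trans k.isLt⟩) := by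
  induction φ generalizing p with
  | input i a => rw [h.2 k hpk hk, layout] at hg; cases hg
  | const q => rw [h.2 k hpk hk, layout] at hg; cases hg
  | add φ ψ hφ hψ =>
    rw [size] at hk
    by_cases h1 : (k : ℕ) < p + φ.size
    · exact hφ hm.1 h.left_of_add hpk h1
    by_cases h2 : (k : ℕ) < p + φ.size + ψ.size
    · exact hψ hm.2 h.right_of_add (by omega) h2
    obtain ⟨l', r', hgate, -, -⟩ := h.gate_of_add (k := k) (by rw [size]; omega)
    rw [hgate] at hg
    cases hg
  | mul φ ψ hφ hψ =>
    rw [size] at hk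
    by_cases h1 : (k : ℕ) < p + φ.size
    · exact hφ hm.1 h.left_of_mul hpk h1
    by_cases h2 : (k : ℕ) < p + φ.size + ψ.size
    · exact hψ hm.2.1 h.right_of_mul (by omega) h2
    obtain ⟨l', r', hgate, hl, hr⟩ := h.gate_of_mul (k := k) (by rw [size]; omega)
    rw [hgate] at hg
    cases hg
    refine ⟨Finset.disjoint_left.2 fun g hgl hgr => ?_, Set.disjoint_left.2 ?_⟩
    · have := (h.left_of_mul.mem_subGates hl hgl).2.1
      have := (h.right_of_mul.mem_subGates hr hgr).1
      omega
    · rintro i ⟨g, hgl, a, hga⟩ ⟨g', hgr, a', hga'⟩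
      exact Set.disjoint_left.1 hm.2.2 ((h.left_of_mul.mem_subGates hl hgl).2.2 i a hga)
        ((h.right_of_mul.mem_subGates hr hgr).2.2 i a' hga')

end IsPlacedAt

/-- The circuit whose gates are the nodes of a formula. -/
def toCircuit (φ : ArithFormula A) : ArithCircuit A where
  size := φ.size
  gate k := φ.layout 0 k
  out := ⟨φ.size - 1, Nat.sub_lt φ.size_pos one_pos⟩

theorem isPlacedAt_toCircuit (φ : ArithFormula A) : φ.IsPlacedAt φ.toCircuit 0 :=
  ⟨by simp [toCircuit], fun _ _ _ => rfl⟩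

theorem eval_toCircuit (φ : ArithFormula A) (x : ∀ i, A i → ℝ) :
    φ.toCircuit.eval x = φ.eval x :=
  φ.isPlacedAt_toCircuit.value_eq x (by
    have := φ.size_pos
    simp only [toCircuit]
    omega)

theorem IsMultilinear.toCircuit {φ : ArithFormula A} (h : φ.IsMultilinear) :
    φ.toCircuit.IsMultilinear := fun k _ _ hg =>
  φ.isPlacedAt_toCircuit.disjoint_of_gate_eq_mul h (Nat.zero_le _)
    (by simpa using (show (k : ℕ) < φ.size from k.isLt)) hg

/-! ### Bit size of the circuit of a formula -/

theorem _root_.Nat.size_le_self (m : ℕ) : Nat.size m ≤ m :=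
  Nat.size_le.2 Nat.lt_two_pow_self

/-- Indices are bounded crudely by their value instead of its logarithm; this is enough for a
polynomial bound. -/
theorem gateBits_layout_le {φ : ArithFormula (fun _ : Fin n => Bool)} (p k : ℕ) :
    ArithCircuit.gateBits (φ.layout p k) ≤ 3 + n + 2 * k + φ.constBits := by
  induction φ generalizing p with
  | input i a =>
    have := Nat.size_le_self i
    have : Nat.size 2 ≤ 2 := Nat.size_le_self 2
    simp only [layout, ArithCircuit.gateBits, Fintype.card_bool]
    omega
  | const q =>
    simp only [layout, ArithCircuit.gateBits, constBits]
    omega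
  | add φ ψ hφ hψ =>
    rw [layout, constBits]
    split_ifs
    · exact (hφ p).trans (by omega)
    · exact (hψ _).trans (by omega)
    · have h1 := Nat.size_le_self (p + φ.size - 1)
      have h2 := Nat.size_le_self (p + φ.size + ψ.size - 1)
      have := φ.size_pos
      simp only [ArithCircuit.gateBits]
      omega
  | mul φ ψ hφ hψ =>
    rw [layout, constBits]
    split_ifs
    · exact (hφ p).trans (by omega)
    · exact (hψ _).trans (by omega)
    · have h1 := Nat.size_le_self (p + φ.size - 1)
      have h2 := Nat.size_le_self (p + φ.size + ψ.size - 1)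
      have := φ.size_pos
      simp only [ArithCircuit.gateBits]
      omega

theorem bitSize_toCircuit_le (φ : ArithFormula (fun _ : Fin n => Bool)) :
    φ.toCircuit.bitSize ≤ φ.size * (4 + n + 2 * φ.size + φ.constBits) := by
  have h1 : Nat.size φ.toCircuit.out ≤ φ.size :=
    (Nat.size_le_self _).trans φ.toCircuit.out.isLt.le
  have h2 : ∑ k, ArithCircuit.gateBits (φ.toCircuit.gate k) ≤
      ∑ _k : Fin φ.size, (3 + n + 2 * φ.size + φ.constBits) :=
    Finset.sum_le_sum fun k _ => (gateBits_layout_le 0 k).trans (by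
      have : (k : ℕ) < φ.size := k.isLt
      omega)
  rw [Finset.sum_const, Finset.card_univ, Fintype.card_fin, smul_eq_mul] at h2
  rw [ArithCircuit.bitSize]
  nlinarith

end ArithFormula

/-! ### Affine dependence on each mixed strategy -/

namespace NormalFormGame

variable {n : ℕ} {A : Fin n → Type} [∀ i, Fintype (A i)] [∀ i, DecidableEq (A i)]

theorem IsMixedProfile.update_pureStrategy {x : ∀ i, A i → ℝ} (hx : IsMixedProfile x) (i : Fin n)
    (b : A i) : IsMixedProfile (Function.update x i (pureStrategy b)) := by
  intro j
  obtain rfl | h := eq_or_ne j i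
  · rw [Function.update_self]
    exact ⟨fun b' => by unfold pureStrategy; split_ifs <;> norm_num, by simp [pureStrategy]⟩
  · rw [Function.update_of_ne h]
    exact hx j

omit [∀ i, Fintype (A i)] in
theorem prod_update_pureStrategy (x : ∀ i, A i → ℝ) (i : Fin n) (b : A i) (a : ∀ j, A j) :
    ∏ j, Function.update x i (pureStrategy b) j (a j) =
      pureStrategy b (a i) * ∏ j ∈ Finset.univ.erase i, x j (a j) := by
  rw [← Finset.mul_prod_erase _ _ (Finset.mem_univ i), Function.update_self]
  congr 1
  exact Finset.prod_congr rfl fun j hj => by rw [Function.update_of_ne (Finset.ne_of_mem_erase hj)]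

/-- The expected utility is affine in the mixed strategy of every player. -/
theorem sum_mul_expectedUtility_update (G : NormalFormGame A) (i k : Fin n) (x : ∀ j, A j → ℝ) :
    ∑ b, x k b * G.expectedUtility i (Function.update x k (pureStrategy b)) =
      G.expectedUtility i x := by
  simp only [expectedUtility, Finset.mul_sum]
  rw [Finset.sum_comm]
  refine Finset.sum_congr rfl fun a _ => ?_
  simp only [prod_update_pureStrategy]
  rw [← Finset.mul_prod_erase _ _ (Finset.mem_univ k)]
  simp only [pureStrategy, ite_mul, one_mul, zero_mul, mul_ite, mul_zero, Finset.sum_ite_eq,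
    Finset.mem_univ, if_true]
  ring

theorem expectedUtility_pureStrategy (G : NormalFormGame A) (i : Fin n) (a : ∀ j, A j) :
    G.expectedUtility i (fun j => pureStrategy (a j)) = G.utility i a := by
  rw [expectedUtility, Finset.sum_eq_single a]
  · simp [pureStrategy]
  · intro b _ hb
    obtain ⟨j, hj⟩ := Function.ne_iff.1 hb
    rw [Finset.prod_eq_zero (Finset.mem_univ j) (by simp [pureStrategy, hj]), mul_zero]
  · simp

/-- A function that is affine in the mixed strategy of every player is determined by its values at
the pure profiles. -/
theorem eq_zero_of_affine (F : (∀ j, A j → ℝ) → ℝ)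
    (haff : ∀ x, IsMixedProfile x → ∀ k,
      F x = ∑ b, x k b * F (Function.update x k (pureStrategy b)))
    (hpure : ∀ a : ∀ j, A j, F (fun j => pureStrategy (a j)) = 0)
    {x : ∀ j, A j → ℝ} (hx : IsMixedProfile x) : F x = 0 := by
  -- Induction on a set `S` outside of which all players play pure strategies; affinity in one
  -- player's strategy makes that player pure.
  suffices h : ∀ (S : Finset (Fin n)) (x : ∀ j, A j → ℝ), IsMixedProfile x →
      (∀ j ∉ S, ∃ b, x j = pureStrategy b) → F x = 0 from
    h Finset.univ x hx fun j hj => absurd (Finset.mem_univ j) hj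
  intro S
  induction S using Finset.induction_on with
  | empty =>
    intro x _ hS
    choose a ha using fun j => hS j (Finset.notMem_empty j)
    rw [show x = fun j => pureStrategy (a j) from funext ha, hpure]
  | insert k S _ ih =>
    intro x hx hS
    rw [haff x hx k]
    refine Finset.sum_eq_zero fun b _ => ?_
    rw [ih _ (hx.update_pureStrategy k b), mul_zero]
    intro j hj
    obtain rfl | h := eq_or_ne j k
    · exact ⟨b, Function.update_self ..⟩
    · rw [Function.update_of_ne h]
      exact hS j (by simp [h, hj])

end NormalFormGame

/-! ### Formulas as identical-interest games -/

namespace ArithFormula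

open NormalFormGame

variable {n : ℕ} {A : Fin n → Type} [∀ i, Fintype (A i)] [∀ i, DecidableEq (A i)]

/-- A multilinear formula is affine in the mixed strategy of every player. -/
theorem IsMultilinear.eval_eq_sum {φ : ArithFormula A} (hφ : φ.IsMultilinear)
    {x : ∀ j, A j → ℝ} (hx : IsMixedProfile x) (k : Fin n) :
    φ.eval x = ∑ b, x k b * φ.eval (Function.update x k (pureStrategy b)) := by
  have hconst : ∀ (ψ : ArithFormula A), k ∉ ψ.players →
      ψ.eval x = ∑ b, x k b * ψ.eval (Function.update x k (pureStrategy b)) := fun ψ hψ => by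
    simp only [eval_update_of_notMem hψ, ← Finset.sum_mul, (hx k).2, one_mul]
  induction φ with
  | input i a =>
    obtain rfl | h := eq_or_ne k i
    · simp [eval, pureStrategy]
    · exact hconst _ h
  | const q => exact hconst _ (Set.notMem_empty k)
  | add φ ψ h1 h2 =>
    simp only [eval, mul_add, Finset.sum_add_distrib]
    rw [h1 hφ.1, h2 hφ.2]
  | mul φ ψ h1 h2 =>
    simp only [eval]
    -- Player `k` occurs in at most one factor; the other factor is a constant that can be pulled
    -- out of the sum.
    by_cases hk : k ∈ φ.players
    · have hk' := Set.disjoint_left.1 hφ.2.2 hk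
      simp only [eval_update_of_notMem hk', ← mul_assoc, ← Finset.sum_mul]
      rw [← h1 hφ.1]
    · simp only [eval_update_of_notMem hk, mul_left_comm _ (φ.eval x), ← Finset.mul_sum]
      rw [← h2 hφ.2.1]

/-- The identical-interest game whose utility is given by a formula. -/
noncomputable def toGame (φ : ArithFormula A) : NormalFormGame A where
  utility _ a := φ.eval fun j => pureStrategy (a j)

/-- Both sides are affine in every player's strategy and agree at pure profiles, so their difference
vanishes. -/
theorem IsMultilinear.expectedUtility_toGame {φ : ArithFormula A} (hφ : φ.IsMultilinear)
    (i : Fin n) {x : ∀ j, A j → ℝ} (hx : IsMixedProfile x) :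
    φ.toGame.expectedUtility i x = φ.eval x := by
  refine sub_eq_zero.1
    (eq_zero_of_affine (fun x => φ.toGame.expectedUtility i x - φ.eval x) ?_ ?_ hx)
  · intro x hx k
    simp only [mul_sub, Finset.sum_sub_distrib]
    rw [sum_mul_expectedUtility_update, ← hφ.eval_eq_sum hx]
  · intro a
    rw [expectedUtility_pureStrategy]
    exact sub_self _

theorem IsMultilinear.computes_toCircuit {φ : ArithFormula A} (hφ : φ.IsMultilinear) :
    φ.toCircuit.Computes φ.toGame := fun i x hx => by
  rw [eval_toCircuit, hφ.expectedUtility_toGame i hx]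

/-- The value of a multilinear formula lies between its values at pure profiles. -/
theorem IsMultilinear.eval_mem_Icc {φ : ArithFormula A} (hφ : φ.IsMultilinear) {l u : ℝ}
    (h : ∀ a : ∀ j, A j, φ.eval (fun j => pureStrategy (a j)) ∈ Set.Icc l u)
    {x : ∀ j, A j → ℝ} (hx : IsMixedProfile x) : φ.eval x ∈ Set.Icc l u := by
  suffices H : ∀ (S : Finset (Fin n)) (x : ∀ j, A j → ℝ), IsMixedProfile x →
      (∀ j ∉ S, ∃ b, x j = pureStrategy b) → φ.eval x ∈ Set.Icc l u from
    H Finset.univ x hx fun j hj => absurd (Finset.mem_univ j) hj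
  intro S
  induction S using Finset.induction_on with
  | empty =>
    intro x _ hS
    choose a ha using fun j => hS j (Finset.notMem_empty j)
    rw [show x = fun j => pureStrategy (a j) from funext ha]
    exact h a
  | insert k S _ ih =>
    intro x hx hS
    rw [hφ.eval_eq_sum hx k]
    -- The value is a convex combination of values at profiles with one more pure player.
    refine (convex_Icc l u).sum_mem (fun b _ => (hx k).1 b) (hx k).2 fun b _ => ?_
    refine ih _ (hx.update_pureStrategy k b) fun j hj => ?_
    obtain rfl | h := eq_or_ne j k
    · exact ⟨b, Function.update_self ..⟩
    · rw [Function.update_of_ne h]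
      exact hS j (by simp [h, hj])

end ArithFormula

/-! ### A long induced path in the cube -/

/-- The position `r` on a path with `P - 1` vertices becomes a position on a path with `2 * P - 1`
vertices, which runs through the shorter path twice: first with the additional coordinates equal
to `00`, and then backwards with the additional coordinates equal to `11`. In between, these are
equal to `01`. -/
def doublePosition (P : ℕ) (a b : Bool) (r : ℕ) : ℕ :=
  match a, b with
  | false, false => r
  | false, true => if r + 1 = P then P else 0
  | true, true => if r = 0 then 0 else 2 * P - r
  | true, false => 0

/-- The position of a vertex of the cube on a long induced path, counted from `1`, and `0` for the
vertices outside of the path. The cube has the coordinates `2, 3, …, 2 * i + 1`. -/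
def snakeRank : ℕ → (ℕ → Bool) → ℕ
  | 0, _ => 1
  | i + 1, y => doublePosition (2 ^ (i + 1)) (y (2 * i + 2)) (y (2 * i + 3)) (snakeRank i y)

/-- A path with `P - 1` vertices is run through twice with one connecting vertex, which gives `2 * P
- 1`. -/
theorem snakeRank_lt (i : ℕ) (y : ℕ → Bool) : snakeRank i y < 2 ^ (i + 1) := by
  induction i with
  | zero => simp [snakeRank]
  | succ i ih =>
    rw [snakeRank, pow_succ 2 (i + 1)]
    generalize 2 ^ (i + 1) = P at *
    cases y (2 * i + 2) <;> cases y (2 * i + 3) <;> simp only [doublePosition] <;>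
      (try split_ifs) <;> omega

/-- Coordinates 0 and 1 are left out because they belong to the switches. -/
theorem snakeRank_update_of_notMem {i m : ℕ} (hm : m < 2 ∨ 2 * i + 2 ≤ m) (y : ℕ → Bool)
    (b : Bool) : snakeRank i (Function.update y m b) = snakeRank i y := by
  induction i with
  | zero => rfl
  | succ i ih =>
    rw [snakeRank, snakeRank, ih (by omega), Function.update_of_ne (by omega),
      Function.update_of_ne (by omega)]

/-- Adjacent vertices of the path are consecutive. -/
theorem snakeRank_update_not {i m : ℕ} (hm : 2 ≤ m) (hm' : m < 2 * i + 2) {y : ℕ → Bool}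
    (hy : snakeRank i y ≠ 0) :
    snakeRank i (Function.update y m (!y m)) = 0 ∨
      snakeRank i (Function.update y m (!y m)) = snakeRank i y + 1 ∨
      snakeRank i (Function.update y m (!y m)) + 1 = snakeRank i y := by
  induction i with
  | zero => omega
  | succ i ih =>
    have hlt := snakeRank_lt i y
    have hlt' := snakeRank_lt i (Function.update y m (!y m))
    rw [snakeRank] at hy ⊢
    rw [snakeRank]
    have hP : 1 < 2 ^ (i + 1) := Nat.one_lt_two_pow i.succ_ne_zero
    generalize 2 ^ (i + 1) = P at *
    rcases lt_or_ge m (2 * i + 2) with h | h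
    -- A flip inside the shorter cube: layer `00` keeps the order, layer `11` reverses it, and layer
    -- `01` contains a single path vertex.
    · rw [Function.update_of_ne (by omega), Function.update_of_ne (by omega)]
      replace ih := or_iff_not_imp_left.2 (ih h)
      generalize snakeRank i (Function.update y m (!y m)) = r' at *
      generalize snakeRank i y = r at *
      generalize y (2 * i + 2) = a at *
      generalize y (2 * i + 3) = b at *
      cases a <;> cases b <;> simp only [doublePosition] at hy ⊢ <;>
        (try split_ifs at hy ⊢) <;> omega
    -- A flip of a new coordinate: layers `00` and `11` differ in two coordinates, so they are
    -- linked only through `01`, where the positions are `P - 1`, `P`, `P + 1`.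
    · rw [snakeRank_update_of_notMem (Or.inr h)]
      clear ih hlt'
      generalize snakeRank i y = r at *
      obtain rfl | rfl : m = 2 * i + 2 ∨ m = 2 * i + 3 := by omega
      all_goals
        rw [Function.update_self, Function.update_of_ne (by omega)]
        generalize y (2 * i + 2) = a at *
        generalize y (2 * i + 3) = b at *
        cases a <;> cases b <;>
          simp only [doublePosition, Bool.not_true, Bool.not_false] at hy ⊢ <;>
          (try split_ifs at hy ⊢) <;> first | omega | simp

/-- Every vertex of the path but the last has a successor, and every vertex but the first has a
predecessor. -/
theorem exists_snakeRank_update (i : ℕ) (y : ℕ → Bool) :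
    (snakeRank i y ≠ 0 → snakeRank i y + 1 < 2 ^ (i + 1) → ∃ m b, m < 2 * i + 2 ∧
      snakeRank i (Function.update y m b) = snakeRank i y + 1) ∧
    (1 < snakeRank i y → ∃ m b, m < 2 * i + 2 ∧
      snakeRank i (Function.update y m b) + 1 = snakeRank i y) := by
  -- Both halves are proved together: on the backward run a successor comes from a predecessor on
  -- the shorter path, and conversely.
  induction i with
  | zero => simp [snakeRank]
  | succ i ih =>
    have hlt := snakeRank_lt i y
    have hinner : ∀ m b, m < 2 * i + 2 → snakeRank (i + 1) (Function.update y m b) =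
        doublePosition (2 ^ (i + 1)) (y (2 * i + 2)) (y (2 * i + 3))
          (snakeRank i (Function.update y m b)) := fun m b hm => by
      rw [snakeRank, Function.update_of_ne (by omega), Function.update_of_ne (by omega)]
    have ha : ∀ b, snakeRank (i + 1) (Function.update y (2 * i + 2) b) =
        doublePosition (2 ^ (i + 1)) b (y (2 * i + 3)) (snakeRank i y) := fun b => by
      rw [snakeRank, Function.update_self, Function.update_of_ne (by omega),
        snakeRank_update_of_notMem (by omega)]
    have hb : ∀ b, snakeRank (i + 1) (Function.update y (2 * i + 3) b) =
        doublePosition (2 ^ (i + 1)) (y (2 * i + 2)) b (snakeRank i y) := fun b => by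
      rw [snakeRank, Function.update_self, Function.update_of_ne (by omega),
        snakeRank_update_of_notMem (by omega)]
    obtain ⟨ih1, ih2⟩ := ih
    rw [show snakeRank (i + 1) y = doublePosition (2 ^ (i + 1)) (y (2 * i + 2)) (y (2 * i + 3))
      (snakeRank i y) from rfl, pow_succ 2 (i + 1)]
    generalize 2 ^ (i + 1) = P at *
    rcases h1 : y (2 * i + 2) <;> rcases h2 : y (2 * i + 3) <;> rw [h1] at hinner hb <;>
      rw [h2] at hinner ha <;> simp only [doublePosition] at hinner ha hb ⊢
    · constructor
      · intro hy hy'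
        by_cases hlast : snakeRank i y + 1 < P
        · obtain ⟨m, b, hm, h⟩ := ih1 hy hlast
          exact ⟨m, b, by omega, by rw [hinner m b hm, h]⟩
        · refine ⟨2 * i + 3, true, by omega, ?_⟩
          rw [hb]
          simp only
          split_ifs <;> omega
      · intro hy
        obtain ⟨m, b, hm, h⟩ := ih2 hy
        exact ⟨m, b, by omega, by rw [hinner m b hm, h]⟩
    · constructor
      · intro hy hy'
        refine ⟨2 * i + 2, true, by omega, ?_⟩
        rw [ha]
        simp only
        split_ifs at hy hy' ⊢ <;> omega
      · intro hy
        refine ⟨2 * i + 3, false, by omega, ?_⟩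
        rw [hb]
        simp only
        split_ifs at hy ⊢ <;> omega
    · simp
    · constructor
      · intro hy hy'
        split_ifs at hy hy' ⊢ with h0
        · omega
        obtain ⟨m, b, hm, h⟩ := ih2 (by omega)
        refine ⟨m, b, by omega, ?_⟩
        rw [hinner m b hm]
        split_ifs <;> omega
      · intro hy
        split_ifs at hy ⊢ with h0
        · omega
        by_cases hlast : snakeRank i y + 1 < P
        · obtain ⟨m, b, hm, h⟩ := ih1 h0 hlast
          refine ⟨m, b, by omega, ?_⟩
          rw [hinner m b hm]
          split_ifs <;> omega
        · refine ⟨2 * i + 2, false, by omega, ?_⟩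
          rw [ha]
          simp only
          split_ifs <;> omega

theorem snakeRank_false (i : ℕ) : snakeRank i (fun _ => false) = 1 := by
  induction i with
  | zero => rfl
  | succ i ih => exact ih

theorem snakeRank_congr {i : ℕ} {y y' : ℕ → Bool} (h : ∀ m, m < 2 * i + 2 → y m = y' m) :
    snakeRank i y = snakeRank i y' := by
  induction i with
  | zero => rfl
  | succ i ih =>
    rw [snakeRank, snakeRank, ih fun m hm => h m (by omega), h _ (by omega), h _ (by omega)]

namespace ArithFormula

open NormalFormGame

/-! ### Formulas for the positions on the path -/

/-- The formulas over the players `0, …, n - 1` with two actions each. -/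
abbrev BoolFormula (n : ℕ) : Type := ArithFormula (fun _ : Fin n => Bool)

variable (n : ℕ) [NeZero n]

/-- The probability that the `i`-th pair of players plays `a` and `b`. -/
def pair (i : ℕ) (a b : Bool) : BoolFormula n :=
  mul (input (Fin.ofNat n (2 * i + 2)) a) (input (Fin.ofNat n (2 * i + 3)) b)

/-- The indicator of the first vertex of the path. -/
def first : ℕ → BoolFormula n
  | 0 => const 1
  | i + 1 => mul (pair n i false false) (first i)

/-- The indicator of the last vertex of the path. -/
def last : ℕ → BoolFormula n
  | 0 => const 1
  | i + 1 => mul (pair n i true true) (first n i)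

/-- The indicator of the path. -/
def onPath : ℕ → BoolFormula n
  | 0 => const 1
  | i + 1 => add (mul (add (pair n i false false) (pair n i true true)) (onPath i))
      (mul (pair n i false true) (last n i))

/-- The position on the path. -/
def position : ℕ → BoolFormula n
  | 0 => const 1
  | i + 1 =>
    -- With `P = 2 ^ (i + 1)` and inner position `r`: layer `00` contributes `r`, layer `01`
    -- contributes `P` at the last vertex, and layer `11` contributes `2 * P - r` on the path.
    add (mul (add (pair n i false false) (mul (const (-1)) (pair n i true true))) (position i))
      (add (mul (mul (const ((2 ^ (i + 1) : ℕ) : ℚ)) (pair n i false true)) (last n i))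
        (mul (mul (const ((2 ^ (i + 2) : ℕ) : ℚ)) (pair n i true true)) (onPath n i)))

/-- The expected number of players in the first pairs that play `true`. -/
def total : ℕ → BoolFormula n
  | 0 => const 0
  | i + 1 => add (add (input (Fin.ofNat n (2 * i + 2)) true) (input (Fin.ofNat n (2 * i + 3)) true))
      (total i)

/-- The probability that the two players outside of the pairs, the switches, play `true`. -/
def switches : BoolFormula n :=
  mul (input (Fin.ofNat n 0) true) (input (Fin.ofNat n 1) true)

/-- The position on the path, plus a large reward for `true` if both switches play `true`. -/
def potential (j : ℕ) : BoolFormula n :=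
  -- The weight is twice `2 ^ (j + 1)`, the bound on the position, so that it still dominates when
  -- the switches are on with probability just above one half.
  add (position n j) (mul (mul (const ((2 ^ (j + 2) : ℕ) : ℚ)) (switches n)) (total n j))

variable {n}

theorem last_succ (i : ℕ) : last n (i + 1) = mul (pair n i true true) (first n i) := rfl

/-- `Fin.ofNat` reduces modulo `n`; `hi` rules out that the indices wrap around. -/
theorem players_pair_subset {i : ℕ} (hi : 2 * i + 4 ≤ n) (a b : Bool) :
    (pair n i a b).players ⊆ {k | 2 * i + 2 ≤ (k : ℕ) ∧ (k : ℕ) < 2 * i + 4} := by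
  rintro k (rfl | rfl) <;>
    simp only [Set.mem_ofPred_eq, Fin.ofNat] <;> rw [Nat.mod_eq_of_lt (by omega)] <;> omega

theorem isMultilinear_pair {i : ℕ} (hi : 2 * i + 4 ≤ n) (a b : Bool) :
    (pair n i a b).IsMultilinear := by
  refine ⟨trivial, trivial, ?_⟩
  simp only [players, Set.disjoint_singleton, ne_eq, Fin.ext_iff, Fin.ofNat]
  rw [Nat.mod_eq_of_lt (by omega), Nat.mod_eq_of_lt (by omega)]
  omega

/-- The recursions refer to one another, so all five formulas go through one induction. -/
theorem players_subset {i : ℕ} (hi : 2 * i + 2 ≤ n) {φ : BoolFormula n}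
    (hφ : φ ∈ [first n i, last n i, onPath n i, position n i, total n i]) :
    φ.players ⊆ {k | 2 ≤ (k : ℕ) ∧ (k : ℕ) < 2 * i + 2} := by
  induction i generalizing φ with
  | zero =>
    intro k hk
    simp only [first, last, onPath, position, total, List.mem_cons, List.not_mem_nil, or_false]
      at hφ
    rcases hφ with rfl | rfl | rfl | rfl | rfl <;> exact absurd hk (Set.notMem_empty k)
  | succ i ih =>
    have hpair : ∀ a b k, k ∈ (pair n i a b).players → 2 ≤ (k : ℕ) ∧ (k : ℕ) < 2 * (i + 1) + 2 :=
      fun a b k hk => by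
        have := players_pair_subset (by omega) a b hk
        simp only [Set.mem_ofPred_eq] at this
        omega
    have hprev : ∀ φ ∈ [first n i, last n i, onPath n i, position n i, total n i], ∀ k,
        k ∈ φ.players → 2 ≤ (k : ℕ) ∧ (k : ℕ) < 2 * (i + 1) + 2 := fun φ hφ k hk => by
      have := ih (by omega) hφ hk
      simp only [Set.mem_ofPred_eq] at this
      omega
    simp only [List.mem_cons, List.not_mem_nil, or_false, forall_eq_or_imp, forall_eq] at hφ hprev
    obtain ⟨h1, h2, h3, h4, h5⟩ := hprev
    intro k hk
    rcases hφ with rfl | rfl | rfl | rfl | rfl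
    · rcases hk with hk | hk
      exacts [hpair _ _ k hk, h1 k hk]
    · rcases hk with hk | hk
      exacts [hpair _ _ k hk, h1 k hk]
    · rcases hk with ((hk | hk) | hk) | (hk | hk)
      exacts [hpair _ _ k hk, hpair _ _ k hk, h3 k hk, hpair _ _ k hk, h2 k hk]
    · rcases hk with ((hk | (hk | hk)) | hk) | (((hk | hk) | hk) | ((hk | hk) | hk))
      exacts [hpair _ _ k hk, absurd hk (Set.notMem_empty k), hpair _ _ k hk, h4 k hk,
        absurd hk (Set.notMem_empty k), hpair _ _ k hk, h2 k hk,
        absurd hk (Set.notMem_empty k), hpair _ _ k hk, h3 k hk]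
    · rcases hk with hk | hk
      exacts [hpair true true k hk, h5 k hk]

theorem players_position_subset {j : ℕ} (hj : 2 * j + 2 ≤ n) :
    (position n j).players ⊆ {k | 2 ≤ (k : ℕ) ∧ (k : ℕ) < 2 * j + 2} :=
  players_subset hj (by simp)

theorem players_total_subset {j : ℕ} (hj : 2 * j + 2 ≤ n) :
    (total n j).players ⊆ {k | 2 ≤ (k : ℕ) ∧ (k : ℕ) < 2 * j + 2} :=
  players_subset hj (by simp)

theorem players_switches_subset (hn : 2 ≤ n) :
    (switches n).players ⊆ {k | (k : ℕ) < 2} := by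
  rintro k (rfl | rfl) <;>
    simp only [Set.mem_ofPred_eq, Fin.ofNat] <;> rw [Nat.mod_eq_of_lt (by omega)] <;> omega

/-- Each recursion step multiplies formulas in earlier players by formulas in a fresh pair. -/
theorem isMultilinear_of_mem {i : ℕ} (hi : 2 * i + 2 ≤ n) {φ : BoolFormula n}
    (hφ : φ ∈ [first n i, last n i, onPath n i, position n i, total n i]) : φ.IsMultilinear := by
  induction i generalizing φ with
  | zero =>
    simp only [first, last, onPath, position, total, List.mem_cons, List.not_mem_nil, or_false]
      at hφ
    rcases hφ with rfl | rfl | rfl | rfl | rfl <;> trivial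
  | succ i ih =>
    have hp : ∀ a b, (pair n i a b).IsMultilinear := isMultilinear_pair (by omega)
    have hps : ∀ a b, (pair n i a b).players ⊆ {k | 2 * i + 2 ≤ (k : ℕ)} := fun a b k hk =>
      (players_pair_subset (by omega) a b hk).1
    have hd : ∀ {ψ : BoolFormula n}, ψ.players ⊆ {k | 2 * i + 2 ≤ (k : ℕ)} →
        ∀ φ ∈ [first n i, last n i, onPath n i, position n i, total n i],
        Disjoint ψ.players φ.players := fun hψ φ hφ => Set.disjoint_left.2 fun k hk hk' => by
      have h1 := hψ hk
      have h2 := players_subset (by omega) hφ hk'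
      simp only [Set.mem_ofPred_eq] at h1 h2
      omega
    have hc : ∀ q a b, (mul (const q) (pair n i a b)).IsMultilinear := fun q a b =>
      ⟨trivial, hp a b, Set.empty_disjoint _⟩
    have hcs : ∀ q a b, (mul (const q) (pair n i a b)).players ⊆ {k | 2 * i + 2 ≤ (k : ℕ)} :=
      fun q a b => Set.union_subset (Set.empty_subset _) (hps a b)
    simp only [List.mem_cons, List.not_mem_nil, or_false] at hφ
    rcases hφ with rfl | rfl | rfl | rfl | rfl
    · exact ⟨hp _ _, ih (by omega) (by simp), hd (hps _ _) _ (by simp)⟩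
    · exact ⟨hp _ _, ih (by omega) (by simp), hd (hps _ _) _ (by simp)⟩
    · exact ⟨⟨⟨hp _ _, hp _ _⟩, ih (by omega) (by simp),
        hd (ψ := add _ _) (Set.union_subset (hps _ _) (hps _ _)) _ (by simp)⟩,
        hp _ _, ih (by omega) (by simp), hd (hps _ _) _ (by simp)⟩
    · exact ⟨⟨⟨hp _ _, hc _ _ _⟩, ih (by omega) (by simp),
        hd (ψ := add _ _) (Set.union_subset (hps _ _) (hcs _ _ _)) _ (by simp)⟩,
        ⟨hc _ _ _, ih (by omega) (by simp), hd (hcs _ _ _) _ (by simp)⟩,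
        hc _ _ _, ih (by omega) (by simp), hd (hcs _ _ _) _ (by simp)⟩
    · exact ⟨⟨trivial, trivial⟩, ih (by omega) (by simp)⟩

theorem isMultilinear_position {j : ℕ} (hj : 2 * j + 2 ≤ n) : (position n j).IsMultilinear :=
  isMultilinear_of_mem hj (by simp)

/-- The position and the reward share players but are only added; inside the reward, the switches
are disjoint from the paired players. -/
theorem isMultilinear_potential {j : ℕ} (hj : 2 * j + 2 ≤ n) : (potential n j).IsMultilinear := by
  refine ⟨isMultilinear_position hj, ⟨trivial, ⟨trivial, trivial, ?_⟩, Set.empty_disjoint _⟩,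
    isMultilinear_of_mem hj (by simp), Set.disjoint_left.2 fun k hk hk' => ?_⟩
  · simp only [players, Set.disjoint_singleton, ne_eq, Fin.ext_iff, Fin.ofNat]
    rw [Nat.mod_eq_of_lt (by omega), Nat.mod_eq_of_lt (by omega)]
    omega
  · have h1 := players_switches_subset (by omega) (hk.resolve_left (Set.notMem_empty k))
    have h2 := players_total_subset hj hk'
    simp only [Set.mem_ofPred_eq] at h1 h2
    omega

/-! ### Sizes -/

theorem size_first (i : ℕ) : (first n i).size = 4 * i + 1 := by
  induction i with
  | zero => rfl
  | succ i ih => simp only [first, pair, size, ih]; ring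

theorem size_last_le (i : ℕ) : (last n i).size ≤ 4 * i + 1 := by
  cases i with
  | zero => rfl
  | succ i => simp only [last, pair, size, size_first]; omega

theorem size_onPath_le (i : ℕ) : (onPath n i).size ≤ 16 * i ^ 2 + 1 := by
  induction i with
  | zero => rfl
  | succ i ih =>
    have := size_last_le (n := n) i
    simp only [onPath, pair, size]
    nlinarith

/-- Although a tree shares no gates, each recursion calls itself only once, so degrees rise by one:
`last` is linear, `onPath` quadratic, `position` cubic. -/
theorem size_position_le (i : ℕ) : (position n i).size ≤ 32 * (i + 1) ^ 3 := by
  induction i with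
  | zero => simp [position, size]
  | succ i ih =>
    have h1 := size_last_le (n := n) i
    have h2 := size_onPath_le (n := n) i
    simp only [position, pair, size]
    have : 32 * (i + 1 + 1) ^ 3 = 32 * (i + 1) ^ 3 + 96 * i ^ 2 + 288 * i + 224 := by ring
    nlinarith

theorem size_total (i : ℕ) : (total n i).size = 4 * i + 1 := by
  induction i with
  | zero => rfl
  | succ i ih => simp only [total, size, ih]; ring

theorem size_potential_le (j : ℕ) : (potential n j).size ≤ 64 * (j + 1) ^ 3 := by
  have h := size_position_le (n := n) j
  have : 32 * (j + 1) ^ 3 = 32 * j ^ 3 + 96 * j ^ 2 + 96 * j + 32 := by ring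
  have : 64 * (j + 1) ^ 3 = 64 * j ^ 3 + 192 * j ^ 2 + 192 * j + 64 := by ring
  simp only [potential, switches, size, size_total]
  omega

omit [NeZero n] in
theorem constBits_const_two_pow (k : ℕ) :
    (const ((2 ^ k : ℕ) : ℚ) : BoolFormula n).constBits = k + 2 := by
  simp [constBits, Nat.size_pow]

theorem constBits_le {i : ℕ} {φ : BoolFormula n}
    (hφ : φ ∈ [first n i, last n i, onPath n i, position n i, total n i]) :
    φ.constBits ≤ i + 4 := by
  have hone : (const 1 : BoolFormula n).constBits ≤ 2 := by simp [constBits]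
  have hzero : (const 0 : BoolFormula n).constBits ≤ 2 := by simp [constBits]
  have hneg : (const (-1) : BoolFormula n).constBits ≤ 2 := by simp [constBits]
  have hpair : ∀ i a b, (pair n i a b).constBits = 0 := fun _ _ _ => rfl
  induction i generalizing φ with
  | zero =>
    simp only [first, last, onPath, position, total, List.mem_cons, List.not_mem_nil, or_false]
      at hφ
    rcases hφ with rfl | rfl | rfl | rfl | rfl <;> omega
  | succ i ih =>
    have h1 := constBits_const_two_pow (n := n) (i + 1)
    have h2 := constBits_const_two_pow (n := n) (i + 2)
    have hf := ih (φ := first n i) (by simp)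
    have hl := ih (φ := last n i) (by simp)
    have ho := ih (φ := onPath n i) (by simp)
    have hp := ih (φ := position n i) (by simp)
    have ht := ih (φ := total n i) (by simp)
    rw [constBits] at h1 h2 hneg
    simp only [List.mem_cons, List.not_mem_nil, or_false] at hφ
    rcases hφ with rfl | rfl | rfl | rfl | rfl <;>
      simp only [first, last_succ, onPath, position, total, constBits, hpair] <;> omega

theorem constBits_potential_le (j : ℕ) : (potential n j).constBits ≤ j + 4 := by
  have h1 := constBits_const_two_pow (n := n) (j + 2)
  have h2 := constBits_le (n := n) (i := j) (φ := position n j) (by simp)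
  have h3 := constBits_le (n := n) (i := j) (φ := total n j) (by simp)
  rw [constBits] at h1
  simp only [potential, switches, constBits]
  omega

/-- An action profile as a mixed profile. -/
noncomputable abbrev pureProfile (a : Fin n → Bool) : Fin n → Bool → ℝ :=
  fun k => pureStrategy (A := fun _ => Bool) (i := k) (a k)

/-! ### Values at action profiles -/

/-- At action profiles the formulas compute the position on the path and its indicators. -/
theorem eval_pureStrategy (i : ℕ) (a : Fin n → Bool) :
    (first n i).eval (pureProfile a) =
      (if snakeRank i (fun m => a (Fin.ofNat n m)) = 1 then 1 else 0) ∧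
    (last n i).eval (pureProfile a) =
      (if snakeRank i (fun m => a (Fin.ofNat n m)) + 1 = 2 ^ (i + 1) then 1 else 0) ∧
    (onPath n i).eval (pureProfile a) =
      (if snakeRank i (fun m => a (Fin.ofNat n m)) = 0 then 0 else 1) ∧
    (position n i).eval (pureProfile a) =
      snakeRank i (fun m => a (Fin.ofNat n m)) := by
  induction i with
  | zero => simp [first, last, onPath, position, eval, snakeRank]
  | succ i ih =>
    obtain ⟨hf, hl, ho, hp⟩ := ih
    have hlt := snakeRank_lt i (fun m => a (Fin.ofNat n m))
    have hP : 1 < 2 ^ (i + 1) := Nat.one_lt_two_pow i.succ_ne_zero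
    have hs : snakeRank (i + 1) (fun m => a (Fin.ofNat n m)) = doublePosition (2 ^ (i + 1))
      (a (Fin.ofNat n (2 * i + 2))) (a (Fin.ofNat n (2 * i + 3)))
      (snakeRank i (fun m => a (Fin.ofNat n m))) := rfl
    simp only [first, last_succ, onPath, position, pair, eval, hf, hl, ho, hp, pureStrategy,
      pow_succ 2 (i + 1)]
    clear hf hl ho hp
    generalize snakeRank (i + 1) (fun m => a (Fin.ofNat n m)) = s at *
    generalize snakeRank i (fun m => a (Fin.ofNat n m)) = r at *
    generalize a (Fin.ofNat n (2 * i + 2)) = u at *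
    generalize a (Fin.ofNat n (2 * i + 3)) = w at *
    generalize 2 ^ (i + 1) = P at *
    cases u <;> cases w <;> simp only [doublePosition] at hs
    · have h1 : s + 1 ≠ P * 2 := by omega
      simp [hs, hs ▸ h1]
    · have h1 : s + 1 ≠ P * 2 := by split_ifs at hs <;> omega
      have h2 : s ≠ 1 := by split_ifs at hs <;> omega
      simp [h1, h2]
      split_ifs at hs with h
      · simp [h, hs]; omega
      · simp [h, hs]
    · simp [hs]; omega
    · split_ifs at hs with h
      · have : r ≠ 1 := by omega
        have : 1 ≠ P * 2 := by omega
        simp_all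
      -- The backward run ends at the first vertex of the shorter path.
      · have h1 : s + 1 = P * 2 ↔ r = 1 := by omega
        have h2 : s ≠ 1 := by omega
        have h3 : s ≠ 0 := by omega
        have h4 : (s : ℝ) = 2 * P - r := by rw [hs, Nat.cast_sub (by omega)]; push_cast; ring
        simp [h1, h2, h3, h, h4]
        ring

end ArithFormula

/-! ### Best responses at fully mixed profiles -/

namespace ArithFormula

open NormalFormGame

variable {n j : ℕ} [NeZero n]

theorem eval_potential (x : ∀ _ : Fin n, Bool → ℝ) :
    (potential n j).eval x = (position n j).eval x +
      2 ^ (j + 2) * (x (Fin.ofNat n 0) true * x (Fin.ofNat n 1) true) * (total n j).eval x := by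
  simp [potential, switches, eval]

/-- The bound holds at pure profiles by `snakeRank_lt` and passes to mixed ones by multilinearity.
-/
theorem eval_position_mem_Icc (hn : n = 2 * j + 2) {x : ∀ _ : Fin n, Bool → ℝ}
    (hx : IsMixedProfile x) : (position n j).eval x ∈ Set.Icc (0 : ℝ) (2 ^ (j + 1)) := by
  refine (isMultilinear_position hn.ge).eval_mem_Icc (fun a => ?_) hx
  rw [(eval_pureStrategy j a).2.2.2]
  exact ⟨Nat.cast_nonneg _, mod_cast (snakeRank_lt j _).le⟩

theorem eval_total_nonneg {x : ∀ _ : Fin n, Bool → ℝ} (hx : ∀ k, 0 ≤ x k true) :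
    0 ≤ (total n j).eval x := by
  induction j with
  | zero => simp [total, eval]
  | succ j ih => exact add_nonneg (add_nonneg (hx _) (hx _)) ih

/-- Supplies the strict incentive of the switches; `hj` guarantees that there is a pair at all. -/
theorem eval_total_pos (hj : 1 ≤ j) {x : ∀ _ : Fin n, Bool → ℝ} (hx : ∀ k, 0 < x k true) :
    0 < (total n j).eval x := by
  obtain ⟨j, rfl⟩ := Nat.exists_eq_add_of_le' hj
  exact add_pos_of_pos_of_nonneg (add_pos (hx _) (hx _)) (eval_total_nonneg fun k => (hx k).le)

theorem eval_total_update (hj : 2 * j + 2 ≤ n) (x : ∀ _ : Fin n, Bool → ℝ) {k : Fin n}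
    (hk : 2 ≤ (k : ℕ)) (hk' : (k : ℕ) < 2 * j + 2) (p : Bool → ℝ) :
    (total n j).eval (Function.update x k p) = (total n j).eval x + p true - x k true := by
  induction j with
  | zero => omega
  | succ j ih =>
    have hval : ∀ m, m < n → ((Fin.ofNat n m : Fin n) : ℕ) = m := fun m hm => Nat.mod_eq_of_lt hm
    have hne : ∀ m, m < n → (k : ℕ) ≠ m → Fin.ofNat n m ≠ k := fun m hm h h' =>
      h (by rw [← h', hval m hm])
    simp only [total, eval]
    rcases lt_or_ge (k : ℕ) (2 * j + 2) with h | h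
    · rw [ih (by omega) h, Function.update_of_ne (hne _ (by omega) (by omega)),
        Function.update_of_ne (hne _ (by omega) (by omega))]
      ring
    · rw [eval_update_of_notMem fun hmem => absurd (players_total_subset (by omega) hmem).2
        (by omega)]
      obtain h | h : (k : ℕ) = 2 * j + 2 ∨ (k : ℕ) = 2 * j + 3 := by omega
      · obtain rfl : k = Fin.ofNat n (2 * j + 2) := Fin.ext (by rw [hval _ (by omega), h])
        rw [Function.update_self, Function.update_of_ne (hne _ (by omega) (by omega))]
        ring
      · obtain rfl : k = Fin.ofNat n (2 * j + 3) := Fin.ext (by rw [hval _ (by omega), h])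
        rw [Function.update_self, Function.update_of_ne (hne _ (by omega) (by omega))]
        ring

theorem ofNat_ne {m : ℕ} (hm : m < n) {k : Fin n} (h : (k : ℕ) ≠ m) : Fin.ofNat n m ≠ k :=
  fun h' => h (by rw [← h']; exact Nat.mod_eq_of_lt hm)

theorem eq_ofNat {m : ℕ} {k : Fin n} (h : (k : ℕ) = m) : k = Fin.ofNat n m :=
  Fin.ext (h.trans (Nat.mod_eq_of_lt (h ▸ k.isLt)).symm)

/-- At fully mixed profiles `true` is the best response of the switches, and if these play `true`
with a high probability, it is the best response of everyone. -/
theorem eval_potential_lt (hn : n = 2 * j + 2) (hj : 1 ≤ j) {x : ∀ _ : Fin n, Bool → ℝ}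
    (hx : IsMixedProfile x) (hpos : ∀ k, 0 < x k true) {k : Fin n}
    (hk : (k : ℕ) < 2 ∨ 1 / 2 < x (Fin.ofNat n 0) true * x (Fin.ofNat n 1) true) :
    (potential n j).eval (Function.update x k (pureStrategy (A := fun _ => Bool) (i := k) false)) <
      (potential n j).eval
        (Function.update x k (pureStrategy (A := fun _ => Bool) (i := k) true)) := by
  rw [eval_potential, eval_potential]
  -- For a switch only the reward changes, by `2 ^ (j + 2)` times the other switch's probability of
  -- `true` times the total, all positive.
  rcases lt_or_ge (k : ℕ) 2 with h | h
  · have h1 : ∀ p, (position n j).eval (Function.update x k p) = (position n j).eval x :=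
      eval_update_of_notMem (fun hmem => absurd (players_position_subset hn.ge hmem).1
        (by omega)) x
    have h2 : ∀ p, (total n j).eval (Function.update x k p) = (total n j).eval x :=
      eval_update_of_notMem (fun hmem => absurd (players_total_subset hn.ge hmem).1
        (by omega)) x
    have h3 := eval_total_pos (n := n) hj hpos
    rw [h1, h1, h2, h2]
    obtain h | h : (k : ℕ) = 0 ∨ (k : ℕ) = 1 := by omega
    · rw [eq_ofNat h, Function.update_self, Function.update_self,
        Function.update_of_ne (ofNat_ne (by omega) (by rw [← eq_ofNat h, h]; omega)),
        Function.update_of_ne (ofNat_ne (by omega) (by rw [← eq_ofNat h, h]; omega))]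
      have := hpos (Fin.ofNat n 1)
      simp only [pureStrategy]
      simp
      positivity
    · rw [eq_ofNat h, Function.update_self, Function.update_self,
        Function.update_of_ne (ofNat_ne (by omega) (by rw [← eq_ofNat h, h]; omega)),
        Function.update_of_ne (ofNat_ne (by omega) (by rw [← eq_ofNat h, h]; omega))]
      have := hpos (Fin.ofNat n 0)
      simp only [pureStrategy]
      simp
      positivity
  -- For a paired player the total grows by one, worth more than `2 ^ (j + 2) / 2 = 2 ^ (j + 1)`,
  -- which covers any loss of position.
  · replace hk := hk.resolve_left (by omega)
    have hF := eval_position_mem_Icc hn (hx.update_pureStrategy k false)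
    have hT := eval_position_mem_Icc hn (hx.update_pureStrategy k true)
    rw [eval_total_update hn.ge x h (by omega), eval_total_update hn.ge x h (by omega)]
    rw [Function.update_of_ne (ofNat_ne (by omega) (by omega)),
      Function.update_of_ne (ofNat_ne (by omega) (by omega)),
      Function.update_of_ne (ofNat_ne (by omega) (by omega)),
      Function.update_of_ne (ofNat_ne (by omega) (by omega))]
    have hpow : (2 : ℝ) ^ (j + 2) = 2 * 2 ^ (j + 1) := by ring
    have hpow' : (0 : ℝ) < 2 ^ (j + 1) := by positivity
    have := mul_lt_mul_of_pos_left hk hpow'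
    have h1 := hF.2
    have h2 := hT.1
    rw [hpow]
    simp only [pureStrategy, if_true, if_false, Bool.true_eq_false]
    nlinarith

/-! ### The perturbed games -/

omit [NeZero n] in
theorem epsPure_apply (ε : ℝ) (a : Fin n → Bool) (k : Fin n) (b : Bool) :
    epsPure ε a k b = if b = a k then 1 - ε else ε := by
  norm_num [epsPure]

omit [NeZero n] in
theorem isMixedProfile_epsPure {ε : ℝ} (hε : 0 < ε) (hε' : ε < 1) (a : Fin n → Bool) :
    IsMixedProfile (epsPure ε a) := by
  intro k
  simp only [epsPure_apply, Fintype.sum_bool]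
  refine ⟨fun b => by split_ifs <;> linarith, ?_⟩
  cases a k <;> simp

omit [NeZero n] in
theorem epsPure_pos {ε : ℝ} (hε : 0 < ε) (hε' : ε < 1) (a : Fin n → Bool) (k : Fin n) (b : Bool) :
    0 < epsPure ε a k b := by
  rw [epsPure_apply]
  split_ifs <;> linarith

/-- Symbolically `true` is the best response of player `k`: the player is a switch, or the switches
play `true`. -/
def PrefersTrue (a : Fin n → Bool) (k : Fin n) : Prop :=
  (k : ℕ) < 2 ∨ a (Fin.ofNat n 0) = true ∧ a (Fin.ofNat n 1) = true

theorem eval_potential_epsPure_lt (hn : n = 2 * j + 2) (hj : 1 ≤ j) {ε : ℝ} (hε : 0 < ε)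
    (hε' : ε < 1 / 10) {a : Fin n → Bool} {k : Fin n} (hk : PrefersTrue a k) :
    (potential n j).eval
        (Function.update (epsPure ε a) k (pureStrategy (A := fun _ => Bool) (i := k) false)) <
      (potential n j).eval
        (Function.update (epsPure ε a) k (pureStrategy (A := fun _ => Bool) (i := k) true)) := by
  refine eval_potential_lt hn hj (isMixedProfile_epsPure hε (by linarith) a)
    (fun k => epsPure_pos hε (by linarith) a k true) (hk.imp_right fun h => ?_)
  -- For `ε < 1 / 10` the product of the switches exceeds `(9 / 10) ^ 2 > 1 / 2`.
  rw [epsPure_apply, epsPure_apply, h.1, h.2, if_pos rfl]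
  nlinarith

/-- The two profiles differ only in how `k` mixes, so by affinity the gain is `1 - 2 * ε` times the
gain between the pure strategies of `k`. -/
theorem expectedUtility_epsPure_lt (hn : n = 2 * j + 2) (hj : 1 ≤ j) {ε : ℝ} (hε : 0 < ε)
    (hε' : ε < 1 / 10) {a : Fin n → Bool} {k : Fin n} (hk : PrefersTrue a k) (hak : a k = false)
    (i : Fin n) :
    (potential n j).toGame.expectedUtility i (epsPure ε a) <
      (potential n j).toGame.expectedUtility i (epsPure ε (Function.update a k true)) := by
  have hlt := eval_potential_epsPure_lt hn hj hε hε' hk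
  have hm := isMultilinear_potential (n := n) hn.ge
  have hx := isMixedProfile_epsPure hε (by linarith) a
  have hx' := isMixedProfile_epsPure hε (by linarith) (Function.update a k true)
  have hupd : ∀ p, Function.update (epsPure ε (Function.update a k true)) k p =
      Function.update (epsPure ε a) k p := fun p => by
    funext l b
    obtain rfl | h := eq_or_ne l k
    · simp
    · simp [Function.update_of_ne h, epsPure_apply]
  rw [hm.expectedUtility_toGame i hx, hm.expectedUtility_toGame i hx', hm.eval_eq_sum hx k,
    hm.eval_eq_sum hx' k]
  simp only [hupd, Fintype.sum_bool, epsPure_apply, Function.update_self, hak]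
  simp only [if_true, if_false, Bool.true_eq_false, Bool.false_eq_true]
  nlinarith

/-- A turn of a player who prefers `true` symbolically sets the action of the player to `true`. -/
theorem eq_update_of_isTurn (hn : n = 2 * j + 2) (hj : 1 ≤ j) {a a' : Fin n → Bool} {k : Fin n}
    (hk : PrefersTrue a k)
    (h : IsTurn (potential n j).toGame.IsSymbolicBetterResponse k a a') :
    a' = Function.update a k true := by
  have hself : ¬ (potential n j).toGame.IsSymbolicBetterResponse k a (a k) := by
    rintro ⟨ε₀, h0, h1⟩
    have := h1 (ε₀ / 2) (by linarith) (by linarith)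
    rw [Function.update_eq_self] at this
    exact lt_irrefl _ this
  cases hak : a k with
  | false =>
    rcases h with ⟨b, hb, rfl⟩ | ⟨hno, -⟩
    · cases b with
      | false => exact absurd (hak ▸ hb) hself
      | true => rfl
    · exact absurd ⟨true, 1 / 10, by norm_num, fun ε h1 h2 =>
        expectedUtility_epsPure_lt hn hj h1 h2 hk hak k⟩ hno
  | true =>
    have hupd : Function.update a k true = a := by rw [← hak, Function.update_eq_self]
    rcases h with ⟨b, hb, rfl⟩ | ⟨-, rfl⟩
    · cases b with
      | true => rfl
      | false =>
        exfalso
        obtain ⟨ε₀, h0, h1⟩ := hb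
        have hk' : PrefersTrue (Function.update a k false) k := by
          refine or_iff_not_imp_left.2 fun h2 => ?_
          rw [Function.update_of_ne (ofNat_ne (by omega) (by omega)),
            Function.update_of_ne (ofNat_ne (by omega) (by omega))]
          exact hk.resolve_left h2
        -- At an `ε` below both thresholds, leaving `true` and returning to it would both be strict
        -- improvements.
        have hε : 0 < min (ε₀ / 2) (1 / 20) := by positivity
        have h2 := h1 _ hε ((min_le_left _ _).trans_lt (by linarith))
        have h3 := expectedUtility_epsPure_lt hn hj hε
          ((min_le_right _ _).trans_lt (by norm_num)) hk' (Function.update_self ..) k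
        rw [Function.update_idem, hupd] at h3
        exact lt_asymm h2 h3
    · exact hupd.symm

/-- A player who prefers `true` symbolically from some time on plays `true` from the next turn
on. -/
theorem eq_true_of_turn (hn : n = 2 * j + 2) (hj : 1 ≤ j) {π : Equiv.Perm (Fin n)}
    {s : ℕ → Fin n → Bool}
    (hs : IsRoundRobinRun (potential n j).toGame.IsSymbolicBetterResponse π s) {k : Fin n} {t₀ : ℕ}
    (hk : ∀ t ≥ t₀, PrefersTrue (s t) k) {t₁ : ℕ} (ht₁ : t₀ ≤ t₁)
    (hturn : (π.symm k : ℕ) = t₁ % n) {t : ℕ} (ht : t₁ + 1 ≤ t) : s t k = true := by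
  induction t, ht using Nat.le_induction with
  | base =>
    have := hs t₁ _ hturn
    rw [Equiv.apply_symm_apply] at this
    rw [eq_update_of_isTurn hn hj (hk t₁ ht₁) this, Function.update_self]
  | succ t ht ih =>
    have hlt : t % n < n := Nat.mod_lt _ (NeZero.pos n)
    have h := hs t ⟨t % n, hlt⟩ rfl
    by_cases hi : π ⟨t % n, hlt⟩ = k
    · rw [hi] at h
      rw [eq_update_of_isTurn hn hj (hk t (by omega)) h, Function.update_self]
    · rcases h with ⟨b, -, h⟩ | ⟨-, h⟩
      · rw [h, Function.update_of_ne (Ne.symm hi), ih]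
      · rw [h, ih]

theorem prefersTrue_of_eq_true {a : Fin n → Bool} (h : ∀ k : Fin n, (k : ℕ) < 2 → a k = true)
    (hn : 2 ≤ n) (k : Fin n) : PrefersTrue a k := by
  refine Or.inr ⟨h _ ?_, h _ ?_⟩ <;> simp only [Fin.ofNat] <;>
    rw [Nat.mod_eq_of_lt (by omega)] <;> omega

/-- In any order the first round turns both switches on, and the second lets everyone else follow.
-/
theorem eq_true_of_two_mul_le (hn : n = 2 * j + 2) (hj : 1 ≤ j) {π : Equiv.Perm (Fin n)}
    {s : ℕ → Fin n → Bool}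
    (hs : IsRoundRobinRun (potential n j).toGame.IsSymbolicBetterResponse π s) {t : ℕ}
    (ht : 2 * n ≤ t) : s t = fun _ => true := by
  have hlt : ∀ k, (π.symm k : ℕ) < n := fun k => (π.symm k).isLt
  have h1 : ∀ t ≥ n, ∀ k : Fin n, (k : ℕ) < 2 → s t k = true := fun t ht k hk =>
    eq_true_of_turn hn hj hs (fun _ _ => Or.inl hk) (Nat.zero_le _)
      (Nat.mod_eq_of_lt (hlt k)).symm (by have := hlt k; omega)
  funext k
  refine eq_true_of_turn hn hj hs
    (fun t ht => prefersTrue_of_eq_true (h1 t ht) (by omega) k) (t₁ := n + π.symm k) (by omega) ?_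
    (by have := hlt k; omega)
  rw [Nat.add_mod_left, Nat.mod_eq_of_lt (hlt k)]

/-- Here the switches have the first two turns, so the others already prefer `true` within the same
round. -/
theorem eq_true_of_le (hn : n = 2 * j + 2) (hj : 1 ≤ j) {s : ℕ → Fin n → Bool}
    (hs : IsRoundRobinRun (potential n j).toGame.IsSymbolicBetterResponse (Equiv.refl _) s) {t : ℕ}
    (ht : n ≤ t) : s t = fun _ => true := by
  have h1 : ∀ t ≥ 2, ∀ k : Fin n, (k : ℕ) < 2 → s t k = true := fun t ht k hk =>
    eq_true_of_turn hn hj hs (fun _ _ => Or.inl hk) (Nat.zero_le _)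
      (t₁ := k) (Nat.mod_eq_of_lt k.isLt).symm (by omega)
  funext k
  by_cases hk : (k : ℕ) < 2
  · exact h1 t (by omega) k hk
  · exact eq_true_of_turn hn hj hs
      (fun t ht => prefersTrue_of_eq_true (h1 t ht) (by omega) k) (t₁ := k) (by omega)
      (Nat.mod_eq_of_lt k.isLt).symm (by omega)

theorem encard_changes_le {α : Type*} {s : ℕ → α} {c : α} {N : ℕ} (h : ∀ t ≥ N, s t = c) :
    {t | s (t + 1) ≠ s t}.encard ≤ N := by
  have hsub : {t | s (t + 1) ≠ s t} ⊆ (Finset.range N : Set ℕ) := fun t ht => by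
    rw [Finset.coe_range, Set.mem_Iio]
    by_contra hN
    exact ht (by rw [h t (by omega), h (t + 1) (by omega)])
  refine (Set.encard_le_encard hsub).trans ?_
  rw [Set.encard_coe_eq_coe_finsetCard, Finset.card_range]

/-- The `ε`-pure profiles around all-`true` are witnesses: `true` is a strict best response there,
and `false` has probability exactly `ε`. The shift by 11 keeps `ε` below `1 / 10`. -/
theorem isPurePerfect_true (hn : n = 2 * j + 2) (hj : 1 ≤ j) :
    (potential n j).toGame.IsPurePerfect fun _ => true := by
  have hpos : ∀ m : ℕ, (0 : ℝ) < 1 / ((m : ℝ) + 11) := fun m => by positivity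
  have hlt : ∀ m : ℕ, 1 / ((m : ℝ) + 11) < 1 / 10 := fun m =>
    one_div_lt_one_div_of_lt (by norm_num) (by linarith [(Nat.cast_nonneg m : (0 : ℝ) ≤ m)])
  have hlim : Tendsto (fun m : ℕ => 1 / ((m : ℝ) + 11)) atTop (𝓝 0) :=
    tendsto_const_nhds.div_atTop (tendsto_atTop_add_const_right _ _ tendsto_natCast_atTop_atTop)
  have hm := isMultilinear_potential (n := n) hn.ge
  refine ⟨fun m => 1 / ((m : ℝ) + 11), fun m => epsPure (1 / ((m : ℝ) + 11)) fun _ => true, hpos,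
    hlim, fun m => ?_, ?_⟩
  · have hx := isMixedProfile_epsPure (hpos m) ((hlt m).trans (by norm_num))
      (fun _ : Fin n => true)
    refine ⟨⟨hx, fun i b => ?_⟩, hx,
      epsPure_pos (hpos m) ((hlt m).trans (by norm_num)) _, fun i b b' hbb => ?_⟩
    · beta_reduce
      rw [epsPure_apply]
      have := hlt m
      split_ifs <;> linarith
    · cases b with
      | false => simp [epsPure_apply]
      | true =>
        exfalso
        cases b' with
        | true => exact lt_irrefl _ hbb
        | false =>
          rw [hm.expectedUtility_toGame i (hx.update_pureStrategy i true),
            hm.expectedUtility_toGame i (hx.update_pureStrategy i false)] at hbb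
          exact lt_asymm hbb
            (eval_potential_epsPure_lt hn hj (hpos m) (hlt m) (Or.inr ⟨rfl, rfl⟩))
  · refine tendsto_pi_nhds.2 fun i => tendsto_pi_nhds.2 fun b => ?_
    simp only [epsPure_apply, pureStrategy]
    split_ifs
    · simpa using tendsto_const_nhds.sub hlim
    · exact hlim

/-! ### Better responses in the game itself -/

/-- The position of an action profile on the path. -/
def rank (j : ℕ) (a : Fin n → Bool) : ℕ := snakeRank j fun m => a (Fin.ofNat n m)

theorem rank_update (hn : n = 2 * j + 2) (a : Fin n → Bool) (k : Fin n) (b : Bool) :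
    rank j (Function.update a k b) =
      snakeRank j (Function.update (fun m => a (Fin.ofNat n m)) k b) := by
  refine snakeRank_congr fun m hm => ?_
  obtain rfl | h := eq_or_ne m (k : ℕ)
  · rw [Function.update_self, ← eq_ofNat rfl, Function.update_self]
  · rw [Function.update_of_ne h, Function.update_of_ne (ofNat_ne (by omega) h.symm)]

/-- One switch that is off already cancels the reward. -/
theorem utility_eq_rank {a : Fin n → Bool}
    (ha : a (Fin.ofNat n 0) = false ∨ a (Fin.ofNat n 1) = false) (i : Fin n) :
    (potential n j).toGame.utility i a = rank j a := by
  change (potential n j).eval (pureProfile a) = _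
  rw [eval_potential, (eval_pureStrategy j a).2.2.2]
  rcases ha with h | h <;> simp only [pureProfile, pureStrategy, h, rank] <;> simp

theorem rank_of_isBetterResponse (hn : n = 2 * j + 2) {a : Fin n → Bool} {k : Fin n} {b : Bool}
    (ha : a (Fin.ofNat n 0) = false ∧ a (Fin.ofNat n 1) = false) (hr : rank j a ≠ 0)
    (h : (potential n j).toGame.IsBetterResponse k a b) :
    (Function.update a k b (Fin.ofNat n 0) = false ∧
      Function.update a k b (Fin.ofNat n 1) = false) ∧
      rank j (Function.update a k b) = rank j a + 1 := by
  have h0 : 2 ≤ (k : ℕ) → Function.update a k b (Fin.ofNat n 0) = false := fun hk => by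
    rw [Function.update_of_ne (ofNat_ne (by omega) (by omega)), ha.1]
  have h1 : (k : ℕ) ≠ 1 → Function.update a k b (Fin.ofNat n 1) = false := fun hk => by
    rw [Function.update_of_ne (ofNat_ne (by omega) hk), ha.2]
  have h01 : Function.update a k b (Fin.ofNat n 0) = false ∨
      Function.update a k b (Fin.ofNat n 1) = false := by
    by_cases hk : (k : ℕ) = 1
    · left
      rw [Function.update_of_ne (ofNat_ne (by omega) (by omega)), ha.1]
    · exact Or.inr (h1 hk)
  rw [IsBetterResponse, utility_eq_rank (Or.inl ha.1), utility_eq_rank h01, Nat.cast_lt] at h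
  -- A switch cannot be the one improving: its flip leaves the other switch off and the position
  -- unchanged.
  have hk : 2 ≤ (k : ℕ) := by
    by_contra hk
    rw [rank_update hn, snakeRank_update_of_notMem (by omega)] at h
    exact lt_irrefl _ h
  have hb : b = !a k := by
    rcases Bool.eq_or_eq_not b (a k) with rfl | hb
    · rw [Function.update_eq_self] at h
      exact absurd h (lt_irrefl _)
    · exact hb
  refine ⟨⟨h0 hk, h1 (by omega)⟩, ?_⟩
  have hstep := snakeRank_update_not (i := j) (y := fun m => a (Fin.ofNat n m)) hk (by omega) hr
  rw [← eq_ofNat rfl, ← hb, ← rank_update hn] at hstep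
  change _ ∨ _ = rank j a + 1 ∨ _ = rank j a at hstep
  omega

/-- A vertex before the last has a successor, and moving there improves the utility. -/
theorem rank_of_isPureNash (hn : n = 2 * j + 2) {a : Fin n → Bool}
    (ha : a (Fin.ofNat n 0) = false ∧ a (Fin.ofNat n 1) = false) (hr : rank j a ≠ 0)
    (h : (potential n j).toGame.IsPureNash a) : 2 ^ (j + 1) ≤ rank j a + 1 := by
  by_contra! hlt
  obtain ⟨m, b, hm, hmb⟩ := (exists_snakeRank_update j fun m => a (Fin.ofNat n m)).1 hr hlt
  have hval : ((Fin.ofNat n m : Fin n) : ℕ) = m := Nat.mod_eq_of_lt (by omega)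
  have hm2 : 2 ≤ m := by
    by_contra hm2
    rw [snakeRank_update_of_notMem (by omega)] at hmb
    omega
  have hu := h (Fin.ofNat n m) b
  rw [utility_eq_rank (Or.inl ha.1), utility_eq_rank (Or.inl (by
    rw [Function.update_of_ne (ofNat_ne (by omega) (by omega)), ha.1])), Nat.cast_le,
    rank_update hn, hval, hmb] at hu
  exact absurd hu (Nat.not_succ_le_self _)

/-- The rank is a step counter: it is 1 at the start, grows by one per step, and must reach `2 ^ (j
+ 1) - 1`. -/
theorem two_pow_le_of_isImprovementPath (hn : n = 2 * j + 2) {L : ℕ} {s : ℕ → Fin n → Bool}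
    (h0 : s 0 = fun _ => false)
    (hs : IsImprovementPath (potential n j).toGame.IsBetterResponse L s)
    (hL : (potential n j).toGame.IsPureNash (s L)) : 2 ^ (j + 1) ≤ L + 2 := by
  have hinv : ∀ t ≤ L, (s t (Fin.ofNat n 0) = false ∧ s t (Fin.ofNat n 1) = false) ∧
      rank j (s t) = t + 1 := by
    intro t
    induction t with
    | zero =>
      intro _
      rw [h0]
      exact ⟨⟨rfl, rfl⟩, snakeRank_false j⟩
    | succ t ih =>
      intro ht
      obtain ⟨ha, hr⟩ := ih (by omega)
      obtain ⟨i, b, hb, hst⟩ := hs t (by omega)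
      rw [hst]
      have := rank_of_isBetterResponse hn ha (by omega) hb
      exact ⟨this.1, by rw [this.2, hr]⟩
  obtain ⟨ha, hr⟩ := hinv L le_rfl
  have := rank_of_isPureNash hn ha (by omega) hL
  omega

theorem bitSize_potential_le (hn : n = 2 * j + 2) :
    (potential n j).toCircuit.bitSize ≤ 8 * n ^ 3 * (16 * n ^ 3 + 2 * n + 8) := by
  have h1 := size_potential_le (n := n) j
  have h2 := constBits_potential_le (n := n) j
  have h3 : 64 * (j + 1) ^ 3 = 8 * n ^ 3 := by rw [hn]; ring
  refine (bitSize_toCircuit_le _).trans (Nat.mul_le_mul (h1.trans h3.le) ?_)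
  omega

end ArithFormula

/-! ### Assembly of the main theorem -/

/-- There is a family of two-action identical-interest games, given by multilinear arithmetic
circuits of size polynomial in the number `n` of players, in which round-robin `ε`-symbolic
better-response dynamics reach a pure perfect equilibrium from everywhere, within `n` turns (so
within `n` improvement steps) in the given order of the players, and within `2 n` turns in any
other order, whereas from some profile every path of ordinary better responses, whoever moves when,
takes at least `2 ^ (c n)` improvement steps to reach a pure Nash equilibrium. With two actions,
better responses and best responses are the same. -/
theorem mainTheorem12 :
    ∃ (c : ℝ) (p : Polynomial ℕ), 0 < c ∧
      ∀ m : ℕ, ∃ (n : ℕ) (G : NormalFormGame (fun _ : Fin n => Bool))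
        (C : ArithCircuit (fun _ : Fin n => Bool)),
        m ≤ n ∧ G.IsIdenticalInterest ∧
        C.IsMultilinear ∧ C.Computes G ∧ C.bitSize ≤ p.eval n ∧
        (∀ s : ℕ → Fin n → Bool,
          NormalFormGame.IsRoundRobinRun G.IsSymbolicBetterResponse (Equiv.refl (Fin n)) s →
            G.IsPurePerfect (s n) ∧ (∀ t ≥ n, s t = s n) ∧
            {t | s (t + 1) ≠ s t}.encard ≤ n) ∧
        (∀ (π : Equiv.Perm (Fin n)) (s : ℕ → Fin n → Bool),
          NormalFormGame.IsRoundRobinRun G.IsSymbolicBetterResponse π s →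
            G.IsPurePerfect (s (2 * n)) ∧ (∀ t ≥ 2 * n, s t = s (2 * n)) ∧
            {t | s (t + 1) ≠ s t}.encard ≤ 2 * n) ∧
        ∃ a : Fin n → Bool, ∀ (L : ℕ) (s : ℕ → Fin n → Bool), s 0 = a →
          NormalFormGame.IsImprovementPath G.IsBetterResponse L s →
          G.IsPureNash (s L) → (2 : ℝ) ^ (c * n) ≤ L := by
  -- With `n = 2 * m + 4`, the exponent `n / 4 = m / 2 + 1` is at most `m + 1`.
  refine ⟨1 / 4, 8 * Polynomial.X ^ 3 * (16 * Polynomial.X ^ 3 + 2 * Polynomial.X + 8),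
    by norm_num, fun m => ?_⟩
  obtain ⟨n, hn⟩ : ∃ n, n = 2 * (m + 1) + 2 := ⟨_, rfl⟩
  have : NeZero n := ⟨by omega⟩
  have hj : 1 ≤ m + 1 := by omega
  have hmul := ArithFormula.isMultilinear_potential (n := n) hn.ge
  refine ⟨n, (ArithFormula.potential n (m + 1)).toGame, (ArithFormula.potential n (m + 1)).toCircuit,
    by omega, fun _ _ _ => rfl, hmul.toCircuit, hmul.computes_toCircuit, ?_, fun s hs => ?_,
    fun π s hs => ?_, fun _ => false, fun L s h0 hs hL => ?_⟩
  · simpa using ArithFormula.bitSize_potential_le hn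
  · have h : ∀ t ≥ n, s t = fun _ => true := fun t => ArithFormula.eq_true_of_le hn hj hs
    refine ⟨?_, fun t ht => by rw [h t ht, h n le_rfl], ArithFormula.encard_changes_le h⟩
    rw [h n le_rfl]
    exact ArithFormula.isPurePerfect_true hn hj
  · have h : ∀ t ≥ 2 * n, s t = fun _ => true := fun t =>
      ArithFormula.eq_true_of_two_mul_le hn hj hs
    refine ⟨?_, fun t ht => by rw [h t ht, h _ le_rfl], ?_⟩
    · rw [h _ le_rfl]
      exact ArithFormula.isPurePerfect_true hn hj
    · exact_mod_cast ArithFormula.encard_changes_le h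
  · have h := ArithFormula.two_pow_le_of_isImprovementPath hn h0 hs hL
    -- From `2 ^ (m + 2) ≤ L + 2`: the deficit of 2 is absorbed because `2 ≤ 2 ^ (m + 1)`.
    have hle : 2 ^ (m + 1) ≤ L := by
      have h1 := Nat.one_lt_two_pow (Nat.succ_ne_zero m)
      have h2 := pow_succ 2 (m + 1)
      omega
    calc (2 : ℝ) ^ (1 / 4 * (n : ℝ)) ≤ 2 ^ ((m + 1 : ℕ) : ℝ) := by
          refine Real.rpow_le_rpow_of_exponent_le one_le_two ?_
          rw [hn]
          push_cast
          linarith [(Nat.cast_nonneg m : (0 : ℝ) ≤ m)]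
      _ = ((2 ^ (m + 1) : ℕ) : ℝ) := by rw [Real.rpow_natCast]; push_cast; rfl
      _ ≤ L := by exact_mod_cast hle
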